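/- Let $\mathfrak g$ be a finite-dimensional complex semisimple Lie algebra with Killing form $\langle\cdot|\cdot\rangle$, equipped with the Lie--Poisson structure $\{F,G\}(y)=\langle y\,|\,[dF(y),dG(y)]\rangle$ (covectors being identified with elements of $\mathfrak g$ by the Killing form). Let $h,e,f\in\mathfrak g$ satisfy $[h,e]=2e$, $[h,f]=-2f$, $[e,f]=h$ (for instance, the canonical $\mathfrak{sl}_2$-triple of a nilpotent adjoint orbit $\mathcal O=\mathbf G\cdot e$; $e=0$ is allowed). Let $\mathfrak g(e)=\{y : [e,y]=0\}$ and let $\mathfrak n$ be an $\operatorname{ad}_h$-invariant subspace with $\mathfrak g=\mathfrak g(e)\oplus\mathfrak n$. Put $N=e+\mathfrak n^\perp$, where $\perp$ is taken with respect to the Killing form. Let $Z_1,\dots,Z_k$ be a basis of $\mathfrak g(e)$ consisting of highest weight vectors, $[h,Z_i]=n_iZ_i$ with $n_i\in\mathbb Z_{\ge0}$, so that $n_1,\dots,n_k$ are the highest weights of $\mathfrak g$ as a module over the triple, and let $X_1,\dots,X_m$ be any basis of $\mathfrak n$. Put $q_i(y)=\langle y-e\,|\,Z_i\rangle$ and $$A_{ij}(y)=\langle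 y|[Z_i,Z_j]\rangle,\qquad B_{ip}(y)=\langle y|[Z_i,X_p]\rangle,\qquad C_{ps}(y)=\langle y|[X_p,X_s]\rangle .$$ Then $\mathfrak g=[\mathfrak g,e]\oplus\mathfrak n^\perp$, i.e. $N$ is a transverse slice to $\mathbf G\cdot e$ at $e$; the functions $q_1,\dots,q_k$ form a coordinate system on $N$, i.e. $(q_1,\dots,q_k):N\to\mathbb C^k$ is a bijection; the matrix $C(y)$ is invertible for every $y\in N$; and the transverse Poisson structure on $N$ is polynomial and quasi-homogeneous of quasi-degree $-2$. Precisely, there is a Poisson bracket $\{\cdot,\cdot\}_N$ on $\mathbb C[q_1,\dots,q_k]$ such that: (a) $\{\cdot,\cdot\}_N$ is obtained from the Lie--Poisson structure by Dirac reduction at every $y\in N$: for every $F\in\mathbb C[q_1,\dots,q_k]$ there is a unique $\xi\in\mathfrak g$ with $\langle v|\xi\rangle=\sum_i\frac{\partial F}{\partial q_i}(y)\langle v|Z_i\rangle$ for all $v\in\mathfrak n^\perp$ and $\langle y|[\xi,x]\rangle=0$ for all $x\in\mathfrak n$, and if $\xi,\eta$ correspond in this way to $F,G$, then $\{F,G\}_N(y)=\langle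 y|[\xi,\eta]\rangle$; in particular its Poisson matrix is $$\bigl(\{q_i,q_j\}_N(y)\bigr)_{i,j}=A(y)+B(y)\,C(y)^{-1}\,B(y)^{\mathsf T}\qquad(y\in N).$$ (b) Call $P\in\mathbb C[q_1,\dots,q_k]$ quasi-homogeneous of quasi-degree $\kappa\in\mathbb Z$ if $P(t^{n_1+2}q_1,\dots,t^{n_k+2}q_k)=t^{\kappa}P(q_1,\dots,q_k)$ for all $t\in\mathbb C$. If $F,G$ are quasi-homogeneous of quasi-degrees $r,s$, then $\{F,G\}_N$ is quasi-homogeneous of quasi-degree $r+s-2$. -/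

import Mathlib

open MvPolynomial

namespace TransversePoisson

section Brackets

variable {k : ℕ}

/-- A bilinear bracket on the polynomial algebra `ℂ[q₁, …, q_k]`. -/
abbrev Bracket (k : ℕ) : Type :=
  MvPolynomial (Fin k) ℂ →ₗ[ℂ] MvPolynomial (Fin k) ℂ →ₗ[ℂ] MvPolynomial (Fin k) ℂ

/-- A (polynomial) Poisson structure: a skew-symmetric bracket which is a derivation in each
argument and which satisfies the Jacobi identity. -/
structure IsPoisson (b : Bracket k) : Prop where
  skew : ∀ F G, b F G = -b G F
  leibniz : ∀ F G H, b F (G * H) = b F G * H + G * b F H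
  jacobi : ∀ F G H, b (b F G) H + b (b G H) F + b (b H F) G = 0

/-- `P` is quasi-homogeneous of quasi-degree `κ` relative to the weights `ν`:
`P(t^ν₁ x₁, …, t^ν_k x_k) = t^κ P(x₁, …, x_k)` for all `t`. (The zero polynomial is
quasi-homogeneous of every quasi-degree.) -/
def IsQuasiHomogeneous (ν : Fin k → ℕ) (P : MvPolynomial (Fin k) ℂ) (κ : ℤ) : Prop :=
  ∀ (t : ℂ) (x : Fin k → ℂ), eval (fun i => t ^ ν i * x i) P = t ^ κ * eval x P

/-- The bracket `b` is quasi-homogeneous of quasi-degree `κ` relative to the weights `ν`: the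
bracket of quasi-homogeneous polynomials of quasi-degrees `r`, `s` is quasi-homogeneous of
quasi-degree `r + s + κ`. -/
def IsQuasiHomogeneousBracket (ν : Fin k → ℕ) (b : Bracket k) (κ : ℤ) : Prop :=
  ∀ (F G : MvPolynomial (Fin k) ℂ) (r s : ℤ), IsQuasiHomogeneous ν F r →
    IsQuasiHomogeneous ν G s → IsQuasiHomogeneous ν (b F G) (r + s + κ)

end Brackets

section LieAlgebra

variable {L : Type*} [LieRing L] [LieAlgebra ℂ L]

/-- The centralizer `𝔤(e) = {y | [e, y] = 0}`, as a subspace. -/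
abbrev centralizer (e : L) : Submodule ℂ L := LinearMap.ker (LieAlgebra.ad ℂ L e)

/-- The orthogonal `𝔫^⊥` of a subspace with respect to the Killing form. -/
noncomputable abbrev perp (n : Submodule ℂ L) : Submodule ℂ L :=
  LinearMap.BilinForm.orthogonal (killingForm ℂ L) n

/-- The affine subspace `N = e + 𝔫^⊥`. -/
def slice (e : L) (n : Submodule ℂ L) : Set L := {y | y - e ∈ perp n}

/-- The Lie–Poisson tensor at `y`, on covectors identified with elements of `𝔤` by the
Killing form `⟨· | ·⟩`: `(ξ, η) ↦ ⟨y | [ξ, η]⟩`. -/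
noncomputable def lieP (y ξ η : L) : ℂ := killingForm ℂ L y ⁅ξ, η⁆

variable {e : L} {n : Submodule ℂ L} {k m : ℕ}

/-- The coordinates `q_i(y) = ⟨y - e | Z_i⟩`, for a basis `Z` of `𝔤(e)`. -/
noncomputable def coord (Z : Module.Basis (Fin k) ℂ (centralizer e)) (y : L) (i : Fin k) : ℂ :=
  killingForm ℂ L (y - e) (Z i : L)

/-- `A(y)_{ij} = ⟨y | [Z_i, Z_j]⟩`. -/
noncomputable def matA (Z : Module.Basis (Fin k) ℂ (centralizer e)) (y : L) :
    Matrix (Fin k) (Fin k) ℂ :=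
  Matrix.of fun i j => lieP y (Z i : L) (Z j : L)

/-- `B(y)_{ip} = ⟨y | [Z_i, X_p]⟩`. -/
noncomputable def matB (Z : Module.Basis (Fin k) ℂ (centralizer e))
    (X : Module.Basis (Fin m) ℂ n) (y : L) : Matrix (Fin k) (Fin m) ℂ :=
  Matrix.of fun i p => lieP y (Z i : L) (X p : L)

/-- `C(y)_{ps} = ⟨y | [X_p, X_s]⟩`. -/
noncomputable def matC (X : Module.Basis (Fin m) ℂ n) (y : L) : Matrix (Fin m) (Fin m) ℂ :=
  Matrix.of fun p s => lieP y (X p : L) (X s : L)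

/-- The Poisson matrix `A(y) + B(y) C(y)⁻¹ B(y)ᵀ` given by Dirac's formula
(meaningful where `C(y)` is invertible). -/
noncomputable def diracMatrix (Z : Module.Basis (Fin k) ℂ (centralizer e))
    (X : Module.Basis (Fin m) ℂ n) (y : L) : Matrix (Fin k) (Fin k) ℂ :=
  matA Z y + matB Z X y * (matC X y)⁻¹ * (matB Z X y).transpose

/-- The covector `ξ` at `y ∈ N = e + 𝔫^⊥` is adapted to the function `F(q₁, …, q_k)` on `N`:
it restricts to the differential of `F` on the tangent space `𝔫^⊥` of `N`, and its Hamiltonian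
vector is tangent to `N`, that is, `⟨y | [ξ, x]⟩ = 0` for all `x ∈ 𝔫`. -/
def IsAdapted (n : Submodule ℂ L) (Z : Module.Basis (Fin k) ℂ (centralizer e)) (y : L)
    (F : MvPolynomial (Fin k) ℂ) (ξ : L) : Prop :=
  (∀ v ∈ perp n, killingForm ℂ L v ξ =
    ∑ i, eval (coord Z y) (pderiv i F) * killingForm ℂ L v (Z i : L)) ∧
  ∀ x ∈ n, lieP y ξ x = 0

/-- `b`, a bracket on the polynomials in the coordinates `q₁, …, q_k`, is the transverse Poisson
structure on the whole of `N = e + 𝔫^⊥`, obtained from the Lie–Poisson structure of `𝔤` by Dirac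
reduction: it is a Poisson structure, every function has a unique adapted covector at every point
of `N`, and `{F, G}_N (y) = ⟨y | [ξ, η]⟩` for the adapted covectors `ξ`, `η` of `F`, `G`
at `y`. -/
structure IsTransversePoisson (n : Submodule ℂ L) (Z : Module.Basis (Fin k) ℂ (centralizer e))
    (b : Bracket k) : Prop where
  isPoisson : IsPoisson b
  existsUnique_adapted : ∀ y ∈ slice e n, ∀ F, ∃! ξ : L, IsAdapted n Z y F ξ
  eval_bracket : ∀ y ∈ slice e n, ∀ F G (ξ η : L), IsAdapted n Z y F ξ → IsAdapted n Z y G η →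
    eval (coord Z y) (b F G) = lieP y ξ η

end LieAlgebra

end TransversePoisson

/-!
The slice `N = e + 𝔫^⊥` is an affine subspace of `𝔤`, and for `z` in `𝔤` the function
`y ↦ ⟨y | z⟩` on `N` is an affine polynomial `l z` in `q₁, …, q_k`. The computation therefore takes
place in `ℂ[q] ⊗ 𝔤`, the Lie algebra of polynomial maps `N → 𝔤`, with the `ℂ[q]`-linear form
`pairing l`, which sends `w` to `y ↦ ⟨y | w y⟩`.

**Invertibility of `C`.** The field `y ↦ 2 y - [h, y]` is tangent to `N`, and on `N` it is the
Euler field `E = ∑ (n_i + 2) q_i ∂/∂q_i`; hence `E (l z) = l [h, z] + 2 l z`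
(`euler_sliceFunction`). If `H` is the matrix of `ad h` on `𝔫`, with `[h, X_p] = ∑ H_{ps} X_s`, then
`E C = (H + 2) C + C Hᵀ`, so that by Jacobi's formula `det C` is an eigenvector of `E`. At `e` it
does not vanish, because `[𝔤, e] ∩ 𝔫^⊥ = 0` and `𝔤(e) ∩ 𝔫 = 0`; as all weights are positive,
`det C` is a non-zero constant (`isUnit_det_blockC`).
The inverse of `C`, and with it the reduced bracket, is thus polynomial.

**Jacobi identity.** Put `ξ_i = Z_i - ∑ (B C⁻¹)_{ip} X_p`, the covector field adapted to `q_i`: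
`⟨y | [ξ_i, x]⟩ = 0` for `x` in `𝔫`. The Poisson matrix is `π_{ij} = ⟨y | [ξ_i, ξ_j]⟩`, and the
Hamiltonian field of `q_i` is `[y, ξ_i]`. Differentiating `π_{js}` along it gives
`⟨y | [ξ_i, [ξ_j, ξ_s]]⟩`, because the derivatives of `ξ_j` and `ξ_s` lie in `𝔫` and drop out
(`coordField_reducedMatrix`); so the Jacobi identity on the coordinates is that of `𝔤`.

**Quasi-homogeneity.** The operator `E ⊗ 1 + 1 ⊗ ad h` is a derivation of `ℂ[q] ⊗ 𝔤`, and by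
uniqueness of adapted covectors `ξ_i` is an eigenvector of it with eigenvalue `n_i`
(`lieEuler_adapted`). Hence `E π_{ij} = (n_i + n_j + 2) π_{ij}`, which is quasi-homogeneity of
degree `-2` for the weights `n_i + 2`, a polynomial being quasi-homogeneous of degree `κ` exactly
when `E P = κ P` (`isQuasiHomogeneous_iff_euler`).

Non-degeneracy of the Killing form is Cartan's criterion.
-/

namespace TransversePoisson

/-! ### Polynomial Poisson brackets defined by a matrix -/

section MatrixBracket

variable {k : ℕ}

lemma derivation_sum_apply {R A ι : Type*} [CommRing R] [CommRing A] [Algebra R A]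
    (s : Finset ι) (D : ι → Derivation R A A) (a : A) : (∑ i ∈ s, D i) a = ∑ i ∈ s, D i a := by
  rw [← Derivation.coeFnAddMonoidHom_apply, map_sum, Finset.sum_apply]
  rfl

/-- The Hamiltonian derivation `∑ i, ∂F/∂q_i • (q_j ↦ π i j)` of `F` for the bracket with Poisson
matrix `π`. -/
noncomputable def hamiltonian (π : Matrix (Fin k) (Fin k) (MvPolynomial (Fin k) ℂ))
    (F : MvPolynomial (Fin k) ℂ) :
    Derivation ℂ (MvPolynomial (Fin k) ℂ) (MvPolynomial (Fin k) ℂ) :=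
  ∑ i, pderiv i F • mkDerivation ℂ (π i)

/-- The bracket `{F, G} = ∑ i j, ∂F/∂q_i * ∂G/∂q_j * π i j` on `ℂ[q₁, …, q_k]`. -/
noncomputable def matrixBracket (π : Matrix (Fin k) (Fin k) (MvPolynomial (Fin k) ℂ)) :
    Bracket k :=
  LinearMap.mk₂ ℂ (fun F G => hamiltonian π F G)
    (fun F F' G => by
      simp [hamiltonian, derivation_sum_apply, add_mul, Finset.sum_add_distrib])
    (fun c F G => by
      simp [hamiltonian, derivation_sum_apply, Finset.smul_sum])
    (fun F G G' => by simp)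
    (fun c F G => by simp)

variable (π : Matrix (Fin k) (Fin k) (MvPolynomial (Fin k) ℂ))

lemma matrixBracket_eq_hamiltonian (F G : MvPolynomial (Fin k) ℂ) :
    matrixBracket π F G = hamiltonian π F G := rfl

lemma derivation_apply_eq_sum_pderiv
    (D : Derivation ℂ (MvPolynomial (Fin k) ℂ) (MvPolynomial (Fin k) ℂ))
    (G : MvPolynomial (Fin k) ℂ) : D G = ∑ j, pderiv j G * D (X j) := by
  have : D = ∑ j, D (X j) • pderiv j := by
    refine MvPolynomial.derivation_ext fun i => ?_
    simp [derivation_sum_apply, pderiv_X, Pi.single_apply]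
  conv_lhs => rw [this]
  simp [derivation_sum_apply, mul_comm]

lemma matrixBracket_eq_sum (F G : MvPolynomial (Fin k) ℂ) :
    matrixBracket π F G = ∑ i, ∑ j, pderiv i F * pderiv j G * π i j := by
  rw [matrixBracket_eq_hamiltonian, hamiltonian, derivation_sum_apply]
  refine Finset.sum_congr rfl fun i _ => ?_
  rw [Derivation.smul_apply, derivation_apply_eq_sum_pderiv (mkDerivation ℂ (π i)) G,
    smul_eq_mul, Finset.mul_sum]
  simp [mul_assoc]

@[simp]
lemma matrixBracket_X_X (i j : Fin k) : matrixBracket π (X i) (X j) = π i j := by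
  simp [matrixBracket_eq_sum, pderiv_X, Pi.single_apply]

variable {π}

lemma matrixBracket_skew (hskew : ∀ i j, π i j = -π j i) (F G : MvPolynomial (Fin k) ℂ) :
    matrixBracket π F G = -matrixBracket π G F := by
  rw [matrixBracket_eq_sum, matrixBracket_eq_sum, Finset.sum_comm, ← Finset.sum_neg_distrib]
  refine Finset.sum_congr rfl fun j _ => ?_
  rw [← Finset.sum_neg_distrib]
  refine Finset.sum_congr rfl fun i _ => ?_
  rw [hskew i j]
  ring

/-- The Jacobiator is cyclically symmetric and, for fixed first two arguments, a derivation in the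
third, so the Jacobi identity only has to be checked on the coordinates. -/
theorem isPoisson_matrixBracket (hskew : ∀ i j, π i j = -π j i)
    (hjac : ∀ i j l, mkDerivation ℂ (π i) (π j l) + mkDerivation ℂ (π j) (π l i) +
      mkDerivation ℂ (π l) (π i j) = 0) : IsPoisson (matrixBracket π) := by
  have skew := matrixBracket_skew hskew
  set b := matrixBracket π with hb
  let J : MvPolynomial (Fin k) ℂ → MvPolynomial (Fin k) ℂ → MvPolynomial (Fin k) ℂ →
    MvPolynomial (Fin k) ℂ := fun F G H => b (b F G) H + b (b G H) F + b (b H F) G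
  have cyc : ∀ F G H, J F G H = J G H F := fun F G H => by simp only [J]; ring
  have hX : ∀ i G, b (X i) G = mkDerivation ℂ (π i) G := fun i G => by
    simp [hb, matrixBracket_eq_hamiltonian, hamiltonian, pderiv_X, Pi.single_apply]
  have lift : ∀ F G, (∀ l, J F G (X l) = 0) → ∀ H, J F G H = 0 := by
    intro F G h0 H
    have key : hamiltonian π (b F G) = ⁅hamiltonian π F, hamiltonian π G⁆ := by
      refine MvPolynomial.derivation_ext fun l => ?_
      have := h0 l
      simp only [J] at this
      rw [Derivation.commutator_apply]
      simp only [← matrixBracket_eq_hamiltonian, ← hb]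
      rw [skew (b G _) F, skew (b _ F) G, skew (X l) F, map_neg] at this
      linear_combination this
    have := DFunLike.congr_fun key H
    rw [Derivation.commutator_apply] at this
    simp only [← matrixBracket_eq_hamiltonian, ← hb] at this
    simp only [J]
    rw [skew (b G _) F, skew (b _ F) G, skew H F, map_neg]
    linear_combination this
  have J0 : ∀ i j l, J (X i) (X j) (X l) = 0 := by
    intro i j l
    have := hjac i j l
    simp only [J]
    rw [skew (b (X i) (X j)) _, skew (b (X j) (X l)) _, skew (b (X l) (X i)) _, hX l, hX i (b _ _),
      hX j (b _ _)]
    simp only [hb, matrixBracket_X_X]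
    linear_combination -this
  have J1 : ∀ i j H, J (X i) (X j) H = 0 := fun i j => lift _ _ (J0 i j)
  have J2 : ∀ i G H, J (X i) G H = 0 := fun i G =>
    lift _ _ fun l => by rw [cyc, cyc]; exact J1 l i G
  refine ⟨skew, fun F G H => ?_, fun F G H => ?_⟩
  · rw [hb, matrixBracket_eq_hamiltonian, Derivation.leibniz, ← matrixBracket_eq_hamiltonian,
      ← matrixBracket_eq_hamiltonian, smul_eq_mul, smul_eq_mul]
    ring
  · exact lift F G (fun l => by rw [cyc, cyc]; exact J2 l F G) H

end MatrixBracket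

/-! ### Quasi-homogeneity and the Euler derivation -/

section Euler

variable {k : ℕ} (ν : Fin k → ℕ)

/-- The Euler derivation `∑ i, ν_i q_i ∂/∂q_i`. -/
noncomputable def euler : Derivation ℂ (MvPolynomial (Fin k) ℂ) (MvPolynomial (Fin k) ℂ) :=
  mkDerivation ℂ fun i => (ν i : ℂ) • X i

@[simp]
lemma euler_X (i : Fin k) : euler ν (X i) = (ν i : ℂ) • X i := mkDerivation_X _ _ _

lemma euler_monomial (d : Fin k →₀ ℕ) (c : ℂ) :
    euler ν (monomial d c) = ((∑ i, d i * ν i : ℕ) : ℂ) • monomial d c := by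
  rw [euler, mkDerivation_monomial, Finsupp.sum_fintype _ _ (by simp)]
  simp only [Nat.cast_sum, Nat.cast_mul, Finset.sum_smul, Finset.smul_sum]
  refine Finset.sum_congr rfl fun i _ => ?_
  rcases Nat.eq_zero_or_pos (d i) with h0 | hpos
  · simp [h0]
  · have hd : d - Finsupp.single i 1 + Finsupp.single i 1 = d :=
      tsub_add_cancel_of_le (Finsupp.single_le_iff.2 hpos)
    rw [smul_eq_mul, mul_smul_comm, X, monomial_mul, hd, mul_one]
    simp [smul_monomial]
    congr 1
    ring

lemma coeff_euler (P : MvPolynomial (Fin k) ℂ) (d : Fin k →₀ ℕ) :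
    coeff d (euler ν P) = ((∑ i, d i * ν i : ℕ) : ℂ) * coeff d P := by
  induction P using MvPolynomial.induction_on' with
  | monomial u a =>
    rw [euler_monomial, coeff_smul, coeff_monomial, smul_eq_mul]
    split_ifs with hu
    · rw [hu]
    · simp
  | add p q hp hq => rw [map_add, coeff_add, hp, hq, coeff_add]; ring

/-- A polynomial is an eigenvector of the Euler derivation exactly when its monomials all have the
weight given by the eigenvalue. -/
lemma euler_eq_smul_iff (P : MvPolynomial (Fin k) ℂ) (c : ℂ) :
    euler ν P = c • P ↔ ∀ d, coeff d P ≠ 0 → ((∑ i, d i * ν i : ℕ) : ℂ) = c := by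
  constructor
  · intro h d hd
    have := congrArg (coeff d) h
    rw [coeff_euler, coeff_smul, smul_eq_mul] at this
    exact mul_right_cancel₀ hd this
  · intro h
    ext d
    rw [coeff_euler, coeff_smul, smul_eq_mul]
    by_cases hd : coeff d P = 0
    · simp [hd]
    · rw [h d hd]

lemma eval_rescale (P : MvPolynomial (Fin k) ℂ) (t : ℂ) (x : Fin k → ℂ) :
    eval (fun i => t ^ ν i * x i) P =
      ∑ d ∈ P.support, t ^ (∑ i, d i * ν i) * (coeff d P * ∏ i, x i ^ d i) := by
  rw [eval_eq']
  refine Finset.sum_congr rfl fun d _ => ?_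
  simp only [mul_pow, Finset.prod_mul_distrib, ← pow_mul, Finset.prod_pow_eq_pow_sum]
  simp only [mul_comm (ν _)]
  ring

theorem isQuasiHomogeneous_iff_euler (P : MvPolynomial (Fin k) ℂ) (κ : ℤ) :
    IsQuasiHomogeneous ν P κ ↔ euler ν P = (κ : ℂ) • P := by
  rw [euler_eq_smul_iff]
  constructor
  · intro h d hd
    -- rescaling by `t = 2` already separates the weights
    have hpoly : (∑ u ∈ P.support, monomial u ((2 : ℂ) ^ (∑ i, u i * ν i) * coeff u P)) =
        C ((2 : ℂ) ^ κ) * P := by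
      refine MvPolynomial.funext fun x => ?_
      rw [map_mul, eval_C, ← h 2 x, eval_rescale, map_sum]
      refine Finset.sum_congr rfl fun u _ => ?_
      rw [eval_monomial, Finsupp.prod_fintype _ _ (by simp), mul_assoc]
    have := congrArg (coeff d) hpoly
    rw [coeff_C_mul, coeff_sum] at this
    simp only [coeff_monomial] at this
    rw [Finset.sum_ite_eq' P.support d, if_pos (mem_support_iff.2 hd)] at this
    have h2 := mul_right_cancel₀ hd this
    rw [← zpow_natCast] at h2
    have h3 : (2 : ℝ) ^ ((∑ i, d i * ν i : ℕ) : ℤ) = 2 ^ κ := by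
      have := congrArg norm h2
      simpa only [norm_zpow, Complex.norm_ofNat] using this
    have h4 := zpow_right_injective₀ (by norm_num : (0 : ℝ) < 2) (by norm_num) h3
    rw [← h4, Int.cast_natCast]
  · intro h t x
    rw [eval_rescale, eval_eq', Finset.mul_sum]
    refine Finset.sum_congr rfl fun d hd => ?_
    have : ((∑ i, d i * ν i : ℕ) : ℤ) = κ := by
      exact_mod_cast h d (mem_support_iff.1 hd)
    rw [← this, zpow_natCast]

/-- A quasi-homogeneous polynomial in variables of positive weight with non-zero constant term is
constant. -/
lemma eq_C_of_euler_eq_smul (hν : ∀ i, 0 < ν i) {P : MvPolynomial (Fin k) ℂ} {c : ℂ}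
    (h : euler ν P = c • P) (h0 : coeff 0 P ≠ 0) : P = C (coeff 0 P) := by
  rw [euler_eq_smul_iff] at h
  have hc : c = 0 := by simpa using (h 0 h0).symm
  ext d
  rw [coeff_C]
  split_ifs with hd
  · rw [← hd]
  · by_contra hne
    have hw := h d hne
    rw [hc, Nat.cast_eq_zero, Finset.sum_eq_zero_iff] at hw
    exact hd <| Eq.symm <| Finsupp.ext fun i => by
      simpa [(hν i).ne'] using hw i (Finset.mem_univ i)

/-- Quasi-homogeneity of a bracket given by a matrix can be read off from the matrix. -/
theorem isQuasiHomogeneousBracket_matrixBracket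
    {π : Matrix (Fin k) (Fin k) (MvPolynomial (Fin k) ℂ)} (hskew : ∀ i j, π i j = -π j i) {κ : ℤ}
    (hπ : ∀ i j, euler ν (π i j) = ((ν i : ℂ) + ν j + κ) • π i j) :
    IsQuasiHomogeneousBracket ν (matrixBracket π) κ := by
  have skew := matrixBracket_skew hskew
  set b := matrixBracket π with hb
  have lift : ∀ F, (∀ l, euler ν (b F (X l)) = b (euler ν F) (X l) + b F (euler ν (X l)) +
      (κ : ℂ) • b F (X l)) →
      ∀ G, euler ν (b F G) = b (euler ν F) G + b F (euler ν G) + (κ : ℂ) • b F G := by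
    intro F h0 G
    have key : ⁅euler ν, hamiltonian π F⁆ =
        hamiltonian π (euler ν F) + (κ : ℂ) • hamiltonian π F := by
      refine MvPolynomial.derivation_ext fun l => ?_
      rw [Derivation.commutator_apply, Derivation.add_apply, Derivation.smul_apply]
      simp only [← matrixBracket_eq_hamiltonian, ← hb]
      rw [h0 l]
      abel
    have := DFunLike.congr_fun key G
    rw [Derivation.commutator_apply, Derivation.add_apply, Derivation.smul_apply] at this
    simp only [← matrixBracket_eq_hamiltonian, ← hb] at this
    rw [sub_eq_iff_eq_add] at this
    rw [this]
    abel
  have hX : ∀ i G, euler ν (b (X i) G) =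
      b (euler ν (X i)) G + b (X i) (euler ν G) + (κ : ℂ) • b (X i) G := by
    intro i
    refine lift _ fun l => ?_
    rw [euler_X, euler_X, map_smul, map_smul, LinearMap.smul_apply, hb, matrixBracket_X_X, hπ,
      add_smul, add_smul]
  have hall : ∀ F G, euler ν (b F G) =
      b (euler ν F) G + b F (euler ν G) + (κ : ℂ) • b F G := by
    intro F
    refine lift _ fun l => ?_
    rw [skew F, map_neg, hX, skew (euler ν F), skew F]
    simp only [smul_neg]
    abel
  intro F G r s hF hG
  rw [isQuasiHomogeneous_iff_euler] at hF hG ⊢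
  rw [hall, hF, hG, map_smul, map_smul, LinearMap.smul_apply, ← add_smul, ← add_smul]
  push_cast
  rfl

end Euler

/-! ### Derivations and determinants -/

section Det

variable {R A ι : Type*} [CommRing R] [CommRing A] [Algebra R A] [DecidableEq ι]

lemma derivation_prod (D : Derivation R A A) (s : Finset ι) (f : ι → A) :
    D (∏ i ∈ s, f i) = ∑ i ∈ s, (∏ j ∈ s.erase i, f j) * D (f i) := by
  induction s using Finset.induction_on with
  | empty => simp
  | insert a s ha ih =>
    rw [Finset.prod_insert ha, Derivation.leibniz, ih, Finset.sum_insert ha,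
      Finset.erase_insert ha, smul_eq_mul, smul_eq_mul, Finset.mul_sum, add_comm]
    congr 1
    refine Finset.sum_congr rfl fun i hi => ?_
    rw [Finset.erase_insert_of_ne (ne_of_mem_of_not_mem hi ha).symm,
      Finset.prod_insert fun h => ha (Finset.mem_of_mem_erase h), mul_assoc]

variable [Fintype ι]

/-- Jacobi's formula for the derivative of a determinant. -/
lemma derivation_det (D : Derivation R A A) (M : Matrix ι ι A) :
    D M.det = (M.adjugate * M.map D).trace := by
  have h : ∀ i, (M.adjugate * M.map D) i i = (M.updateCol i fun j => D (M j i)).det := by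
    intro i
    rw [← Matrix.cramer_apply, Matrix.cramer_eq_adjugate_mulVec]
    rfl
  simp only [Matrix.trace, Matrix.diag, h]
  simp only [Matrix.det_apply]
  rw [map_sum, Finset.sum_comm]
  refine Finset.sum_congr rfl fun σ _ => ?_
  rw [← Finset.smul_sum, Units.smul_def, map_zsmul, Units.smul_def]
  congr 1
  rw [derivation_prod]
  refine Finset.sum_congr rfl fun i _ => ?_
  rw [← Finset.prod_erase_mul _ _ (Finset.mem_univ i), Matrix.updateCol_self]
  congr 1
  exact Finset.prod_congr rfl fun j hj => (Matrix.updateCol_ne (Finset.ne_of_mem_erase hj)).symm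

/-- If `D M = G M + M H` then `det M` is an eigenvector of `D` up to the factor `tr G + tr H`. -/
lemma derivation_det_of_map_eq (D : Derivation R A A) {M G H : Matrix ι ι A}
    (h : M.map D = G * M + M * H) : D M.det = (G.trace + H.trace) * M.det := by
  rw [derivation_det, h, mul_add, Matrix.trace_add, ← mul_assoc, Matrix.trace_mul_comm,
    ← mul_assoc, Matrix.mul_adjugate, ← mul_assoc, Matrix.adjugate_mul]
  simp
  ring

end Det

/-! ### Dirac reduction over a ring of functions -/

section Dirac

open TensorProduct

variable {R A L ι κ : Type*} [CommRing R] [CommRing A] [Algebra R A] [LieRing L] [LieAlgebra R L]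

lemma rTensor_derivation_lie (D : Derivation R A A) (v w : A ⊗[R] L) :
    LinearMap.rTensor L (D : A →ₗ[R] A) ⁅v, w⁆ =
      ⁅LinearMap.rTensor L (D : A →ₗ[R] A) v, w⁆ +
        ⁅v, LinearMap.rTensor L (D : A →ₗ[R] A) w⁆ := by
  induction v with
  | zero => simp
  | add v v' hv hv' =>
    simp only [add_lie, map_add, hv, hv']
    abel
  | tmul a x =>
    induction w with
    | zero => simp
    | add w w' hw hw' =>
      simp only [lie_add, map_add, hw, hw']
      abel
    | tmul b y =>
      simp only [LieAlgebra.ExtendScalars.bracket_tmul, LinearMap.rTensor_tmul,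
        Derivation.coeFn_coe, Derivation.leibniz, smul_eq_mul, TensorProduct.add_tmul]
      rw [add_comm, mul_comm b]

lemma tmul_eq_smul_one_tmul' (a : A) (z : L) : a ⊗ₜ[R] z = a • ((1 : A) ⊗ₜ[R] z) := by
  rw [TensorProduct.smul_tmul', smul_eq_mul, mul_one]

variable [Fintype κ] [DecidableEq κ] (W : Module.Basis (ι ⊕ κ) R L) (l : L →ₗ[R] A)

/-- The `A`-linear extension of `l` to `A ⊗ 𝔤`. If `A` is an algebra of functions on a subset `N`
of `𝔤` and `l z` is the function `y ↦ ⟨y | z⟩`, then this sends a map `w : N → 𝔤` to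
`y ↦ ⟨y | w y⟩`. -/
noncomputable abbrev pairing : A ⊗[R] L →ₗ[A] A := l.liftBaseChange A

/-- The block of the Lie–Poisson tensor on the vectors `W (inl i)`, as a matrix of
functions. -/
noncomputable def blockA : Matrix ι ι A := Matrix.of fun i j => l ⁅W (.inl i), W (.inl j)⁆

/-- The block of the Lie–Poisson tensor between the vectors `W (inl i)` and `W (inr p)`, as a matrix of
functions. -/
noncomputable def blockB : Matrix ι κ A := Matrix.of fun i p => l ⁅W (.inl i), W (.inr p)⁆

/-- The block of the Lie–Poisson tensor on the vectors `W (inr p)`, as a matrix of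
functions. -/
noncomputable def blockC : Matrix κ κ A := Matrix.of fun p s => l ⁅W (.inr p), W (.inr s)⁆

/-- The coefficients `-B C⁻¹` of the adapted covectors on the vectors `W (inr p)`. -/
noncomputable def adaptedCoeff : Matrix ι κ A := -(blockB W l * (blockC W l)⁻¹)

/-- The covector field adapted to the `i`-th coordinate function: the combination of `W (inl i)`
and the `W (inr p)` which is orthogonal to all `W (inr s)` for the Poisson tensor. -/
noncomputable def adapted (i : ι) : A ⊗[R] L :=
  1 ⊗ₜ W (.inl i) + ∑ p, adaptedCoeff W l i p ⊗ₜ W (.inr p)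

/-- The Poisson matrix of the reduced bracket: the Poisson tensor on adapted covector fields. -/
noncomputable def reducedMatrix : Matrix ι ι A :=
  Matrix.of fun i j => pairing l ⁅adapted W l i, adapted W l j⁆

lemma reducedMatrix_apply (i j : ι) :
    reducedMatrix W l i j = pairing l ⁅adapted W l i, adapted W l j⁆ := rfl

lemma reducedMatrix_skew (i j : ι) : reducedMatrix W l i j = -reducedMatrix W l j i := by
  rw [reducedMatrix_apply, reducedMatrix_apply, ← lie_skew, map_neg]

lemma rTensor_adapted (D : Derivation R A A) (i : ι) :
    LinearMap.rTensor L (D : A →ₗ[R] A) (adapted W l i) =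
      ∑ p, D (adaptedCoeff W l i p) ⊗ₜ[R] W (.inr p) := by
  simp [adapted]

variable {W l} (hC : IsUnit (blockC W l).det)
include hC

/-- The matrix `C` detects the combinations of the `W (inr p)`. -/
lemma eq_zero_of_pairing_sum_eq_zero (c : κ → A)
    (h : ∀ s, pairing l ⁅∑ p, c p ⊗ₜ[R] W (.inr p), (1 : A) ⊗ₜ[R] W (.inr s)⁆ = 0) :
    c = 0 := by
  have hc : Matrix.vecMul c (blockC W l) = 0 := by
    funext s
    rw [Pi.zero_apply, ← h s]
    simp [Matrix.vecMul, dotProduct, blockC, sum_lie]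
  have := congrArg (fun v => Matrix.vecMul v (blockC W l)⁻¹) hc
  simpa [Matrix.vecMul_vecMul, Matrix.mul_nonsing_inv _ hC] using this

lemma pairing_adapted_inr (i : ι) (s : κ) :
    pairing l ⁅adapted W l i, (1 : A) ⊗ₜ[R] W (.inr s)⁆ = 0 := by
  have : (blockB W l + adaptedCoeff W l * blockC W l) i s = 0 := by
    rw [adaptedCoeff, Matrix.neg_mul, Matrix.mul_assoc, Matrix.nonsing_inv_mul _ hC,
      Matrix.mul_one, add_neg_cancel]
    rfl
  rw [← this]
  simp [adapted, add_lie, sum_lie, Matrix.mul_apply, blockB, blockC]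

lemma pairing_adapted_sum (i : ι) (c : κ → A) :
    pairing l ⁅adapted W l i, ∑ p, c p ⊗ₜ[R] W (.inr p)⁆ = 0 := by
  rw [lie_sum, map_sum]
  refine Finset.sum_eq_zero fun p _ => ?_
  rw [tmul_eq_smul_one_tmul', lie_smul, map_smul, pairing_adapted_inr hC, smul_zero]

lemma pairing_adapted_inl (i j : ι) :
    pairing l ⁅adapted W l i, (1 : A) ⊗ₜ[R] W (.inl j)⁆ = reducedMatrix W l i j := by
  rw [reducedMatrix_apply]
  conv_rhs => rw [adapted.eq_1 W l j]
  rw [lie_add, map_add, pairing_adapted_sum hC, add_zero]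

/-- Dirac's formula. -/
lemma reducedMatrix_eq : reducedMatrix W l =
    blockA W l + blockB W l * (blockC W l)⁻¹ * (blockB W l).transpose := by
  ext i j
  rw [← pairing_adapted_inl hC]
  have : ∀ p, l ⁅W (.inr p), W (.inl j)⁆ = -blockB W l j p := fun p => by
    rw [blockB, Matrix.of_apply, ← lie_skew, map_neg]
  rw [Matrix.add_apply, Matrix.mul_apply]
  simp [adapted, add_lie, sum_lie, this, adaptedCoeff, blockA]

section Jacobi

variable {D : ι → Derivation R A A} (hl : ∀ i j, D i (l (W (.inl j))) = reducedMatrix W l i j)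
  (hr : ∀ i p, D i (l (W (.inr p))) = 0)
include hl hr

/-- The Hamiltonian vector field at `y` of the `i`-th coordinate is `[y, ξ_i]`, where `ξ_i` is the
adapted covector. -/
lemma coordField_apply (i : ι) (z : L) :
    D i (l z) = pairing l ⁅adapted W l i, (1 : A) ⊗ₜ[R] z⁆ := by
  let g : L →ₗ[R] A := (pairing l).restrictScalars R ∘ₗ
    (LieAlgebra.ad R (A ⊗[R] L) (adapted W l i) : A ⊗[R] L →ₗ[R] A ⊗[R] L) ∘ₗ
      TensorProduct.mk R A L 1
  suffices (D i : A →ₗ[R] A) ∘ₗ l = g from LinearMap.congr_fun this z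
  refine W.ext fun x => ?_
  rcases x with j | p
  · exact (hl i j).trans (pairing_adapted_inl hC i j).symm
  · exact (hr i p).trans (pairing_adapted_inr hC i p).symm

lemma coordField_pairing (i : ι) (w : A ⊗[R] L) :
    D i (pairing l w) = pairing l ⁅adapted W l i, w⁆ +
      pairing l (LinearMap.rTensor L (D i : A →ₗ[R] A) w) := by
  induction w with
  | zero => simp
  | add v w hv hw =>
    simp only [map_add, lie_add, hv, hw]
    abel
  | tmul a z =>
    rw [tmul_eq_smul_one_tmul' a z, lie_smul, ← tmul_eq_smul_one_tmul', LinearMap.rTensor_tmul,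
      map_smul, LinearMap.liftBaseChange_tmul, LinearMap.liftBaseChange_tmul,
      ← coordField_apply hC hl hr, smul_eq_mul, smul_eq_mul, smul_eq_mul, Derivation.leibniz,
      smul_eq_mul, smul_eq_mul, mul_comm (l z)]
    rfl

/-- The derivatives of the adapted covectors `ξ_j`, `ξ_s` are combinations of the `W (inr p)` and
do not contribute, because `ξ_s` and `ξ_j` are orthogonal to these. -/
lemma coordField_reducedMatrix (i j s : ι) :
    D i (reducedMatrix W l j s) =
      pairing l ⁅adapted W l i, ⁅adapted W l j, adapted W l s⁆⁆ := by
  rw [reducedMatrix_apply, coordField_pairing hC hl hr, rTensor_derivation_lie, rTensor_adapted,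
    rTensor_adapted, map_add, pairing_adapted_sum hC, ← lie_skew (∑ _, _) _, map_neg,
    pairing_adapted_sum hC]
  simp

/-- The Jacobi identity for the coordinates follows from the Jacobi identity of the Lie algebra. -/
theorem coordField_reducedMatrix_jacobi (i j s : ι) :
    D i (reducedMatrix W l j s) + D j (reducedMatrix W l s i) +
      D s (reducedMatrix W l i j) = 0 := by
  simp only [coordField_reducedMatrix hC hl hr]
  rw [← map_add, ← map_add, lie_jacobi, map_zero]

end Jacobi

end Dirac

/-! ### Weights of the reduced bracket -/

section Weights

open TensorProduct

variable {R A L ι κ : Type*} [CommRing R] [CommRing A] [Algebra R A] [LieRing L] [LieAlgebra R L]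

/-- The Lie derivative `E ⊗ 1 + 1 ⊗ ad h` on `A ⊗ 𝔤`. -/
noncomputable def lieEuler (E : Derivation R A A) (h : L) : A ⊗[R] L →ₗ[R] A ⊗[R] L :=
  LinearMap.rTensor L (E : A →ₗ[R] A) + LieAlgebra.ad R (A ⊗[R] L) (1 ⊗ₜ h)

variable {E : Derivation R A A} {h : L}

lemma lieEuler_tmul (a : A) (z : L) :
    lieEuler E h (a ⊗ₜ z) = E a ⊗ₜ z + a ⊗ₜ ⁅h, z⁆ := by
  simp [lieEuler]

lemma lieEuler_lie (v w : A ⊗[R] L) :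
    lieEuler E h ⁅v, w⁆ = ⁅lieEuler E h v, w⁆ + ⁅v, lieEuler E h w⁆ := by
  simp only [lieEuler, LinearMap.add_apply, rTensor_derivation_lie, add_lie, lie_add,
    LieAlgebra.ad_apply]
  rw [leibniz_lie (1 ⊗ₜ h)]
  abel

variable [Fintype κ] [DecidableEq κ] {W : Module.Basis (ι ⊕ κ) R L} {l : L →ₗ[R] A}
  (hE : ∀ z, E (l z) = l ⁅h, z⁆ + (2 : R) • l z)
  {H : Matrix κ κ R} (hH : ∀ p, ⁅h, W (.inr p)⁆ = ∑ s, H p s • W (.inr s))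

include hE in
omit [Fintype κ] [DecidableEq κ] in
lemma euler_pairing (w : A ⊗[R] L) :
    E (pairing l w) = pairing l (lieEuler E h w) + (2 : R) • pairing l w := by
  induction w with
  | zero => simp
  | add v w hv hw =>
    simp only [map_add, hv, hw, smul_add]
    abel
  | tmul a z =>
    rw [lieEuler_tmul, map_add]
    simp only [LinearMap.liftBaseChange_tmul, smul_eq_mul, Derivation.leibniz, hE, mul_add,
      mul_smul_comm]
    ring

include hE hH in
lemma euler_blockC : (blockC W l).map E =
    (H.map (algebraMap R A) + 2) * blockC W l +
      blockC W l * (H.map (algebraMap R A)).transpose := by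
  ext p s
  have h1 : l ⁅h, ⁅W (.inr p), W (.inr s)⁆⁆ =
      (H.map (algebraMap R A) * blockC W l) p s +
        (blockC W l * (H.map (algebraMap R A)).transpose) p s := by
    rw [leibniz_lie, hH, hH]
    simp [Matrix.mul_apply, sum_lie, lie_sum, blockC, Algebra.smul_def,
      mul_comm]
  have h2 : (2 * blockC W l : Matrix κ κ A) p s = (2 : R) • l ⁅W (.inr p), W (.inr s)⁆ := by
    rw [two_mul, Matrix.add_apply, two_smul]
    rfl
  rw [Matrix.map_apply, add_mul, Matrix.add_apply, Matrix.add_apply, h2]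
  change E (l _) = _
  rw [hE, h1]
  abel

include hH in
omit [DecidableEq κ] in
lemma lieEuler_sum_inr (c : κ → A) :
    ∃ c' : κ → A, lieEuler E h (∑ p, c p ⊗ₜ W (.inr p)) = ∑ p, c' p ⊗ₜ[R] W (.inr p) := by
  refine ⟨fun s => E (c s) + ∑ p, H p s • c p, ?_⟩
  simp only [map_sum, lieEuler_tmul, hH, TensorProduct.add_tmul, Finset.sum_add_distrib,
    TensorProduct.tmul_sum, TensorProduct.sum_tmul, TensorProduct.tmul_smul]
  congr 1
  rw [Finset.sum_comm]
  rfl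

variable (hC : IsUnit (blockC W l).det) {wt : ι → R}
  (hwt : ∀ i, ⁅h, W (.inl i)⁆ = wt i • W (.inl i))
include hE hH hC hwt

/-- By uniqueness of adapted covectors, the one adapted to the `i`-th coordinate has the same
weight as `W (inl i)`. -/
lemma lieEuler_adapted (i : ι) : lieEuler E h (adapted W l i) = wt i • adapted W l i := by
  obtain ⟨c, hc⟩ := lieEuler_sum_inr (E := E) hH (adaptedCoeff W l i)
  have h1 : lieEuler E h (adapted W l i) = wt i • adapted W l i +
      ∑ p, (c p - wt i • adaptedCoeff W l i p) ⊗ₜ[R] W (.inr p) := by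
    simp only [TensorProduct.sub_tmul, Finset.sum_sub_distrib, ← hc]
    simp [adapted, lieEuler_tmul, hwt, Finset.smul_sum, TensorProduct.smul_tmul']
  -- this combination of the `W (inr p)` is orthogonal to all of them, so it vanishes
  have h2 : (fun p => c p - wt i • adaptedCoeff W l i p) = 0 := by
    refine eq_zero_of_pairing_sum_eq_zero hC _ fun s => ?_
    have h3 : ∑ p, (c p - wt i • adaptedCoeff W l i p) ⊗ₜ[R] W (.inr p) =
      lieEuler E h (adapted W l i) - wt i • adapted W l i := by rw [h1]; abel
    have h4 := euler_pairing hE ⁅adapted W l i, (1 : A) ⊗ₜ[R] W (.inr s)⁆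
    obtain ⟨c', hc'⟩ := lieEuler_sum_inr (E := E) hH (Pi.single s 1)
    have h5 : ∑ p, (Pi.single s 1 : κ → A) p ⊗ₜ[R] W (.inr p) = 1 ⊗ₜ W (.inr s) := by
      rw [Finset.sum_eq_single s (by intro b _ hb; simp [hb]) (by simp), Pi.single_eq_same]
    rw [h5] at hc'
    rw [lieEuler_lie, hc', map_add, pairing_adapted_sum hC, pairing_adapted_inr hC] at h4
    rw [h3, sub_lie, map_sub, smul_lie, LinearMap.map_smul_of_tower, pairing_adapted_inr hC]
    simpa using h4.symm
  rw [h1]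
  simp [fun p => congrFun h2 p]

theorem euler_reducedMatrix (i j : ι) :
    E (reducedMatrix W l i j) = (wt i + wt j + 2) • reducedMatrix W l i j := by
  rw [reducedMatrix_apply, euler_pairing hE, lieEuler_lie, lieEuler_adapted hE hH hC hwt,
    lieEuler_adapted hE hH hC hwt, smul_lie, lie_smul, ← add_smul, LinearMap.map_smul_of_tower,
    ← add_smul]

end Weights

/-! ### Evaluation at a point -/

section Evaluation

open TensorProduct

variable {R A L : Type*} [CommRing R] [CommRing A] [Algebra R A] [LieRing L] [LieAlgebra R L]

/-- The value of an element of `A ⊗ 𝔤`, seen as a map with values in `𝔤`, at the point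
given by the character `φ` of `A`. -/
noncomputable def evalTensor (L : Type*) [LieRing L] [LieAlgebra R L] (φ : A →ₐ[R] R) :
    A ⊗[R] L →ₗ[R] L :=
  (TensorProduct.lid R L : R ⊗[R] L →ₗ[R] L) ∘ₗ LinearMap.rTensor L φ.toLinearMap

@[simp]
lemma evalTensor_tmul (φ : A →ₐ[R] R) (a : A) (z : L) : evalTensor L φ (a ⊗ₜ z) = φ a • z := by
  simp [evalTensor]

lemma evalTensor_lie (φ : A →ₐ[R] R) (v w : A ⊗[R] L) :
    evalTensor L φ ⁅v, w⁆ = ⁅evalTensor L φ v, evalTensor L φ w⁆ := by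
  induction v with
  | zero => simp
  | add v v' hv hv' => simp only [add_lie, map_add, hv, hv']
  | tmul a x =>
    induction w with
    | zero => simp
    | add w w' hw hw' => simp only [lie_add, map_add, hw, hw']
    | tmul b y => simp [mul_smul, smul_comm (φ b)]

lemma map_pairing {φ : A →ₐ[R] R} {l : L →ₗ[R] A} {β : L →ₗ[R] R} (hβ : ∀ z, φ (l z) = β z)
    (w : A ⊗[R] L) : φ (pairing l w) = β (evalTensor L φ w) := by
  induction w with
  | zero => simp
  | add v w hv hw => simp only [map_add, hv, hw]
  | tmul a z => simp [hβ]

end Evaluation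

/-! ### The Killing form and the transverse slice -/

section Slice

variable {L : Type*} [LieRing L] [LieAlgebra ℂ L]

lemma mem_perp_iff {n : Submodule ℂ L} {v : L} :
    v ∈ perp n ↔ ∀ x ∈ n, killingForm ℂ L v x = 0 := by
  rw [LinearMap.BilinForm.mem_orthogonal_iff]
  refine forall₂_congr fun x _ => ?_
  exact Eq.congr_left (LieModule.traceForm_comm ℂ L L x v)

lemma lieP_eq_killingForm_lie (y ξ η : L) : lieP y ξ η = killingForm ℂ L ⁅y, ξ⁆ η :=
  (LieModule.traceForm_apply_lie_apply ℂ L L y ξ η).symm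

/-- Cartan's criterion, in the form of Mathlib's instance from trivial radical to `IsKilling`. -/
lemma killingForm_nondegenerate [FiniteDimensional ℂ L] [LieAlgebra.IsSemisimple ℂ L] :
    (killingForm ℂ L).Nondegenerate :=
  LieAlgebra.IsKilling.killingForm_nondegenerate ℂ L

lemma perp_perp [FiniteDimensional ℂ L] [LieAlgebra.IsSemisimple ℂ L]
    (n : Submodule ℂ L) : perp (perp n) = n :=
  LinearMap.BilinForm.orthogonal_orthogonal killingForm_nondegenerate
    (LieModule.traceForm_isSymm ℂ L L).isRefl n

lemma finrank_perp [FiniteDimensional ℂ L] [LieAlgebra.IsSemisimple ℂ L] (n : Submodule ℂ L) :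
    Module.finrank ℂ (perp n) = Module.finrank ℂ L - Module.finrank ℂ n :=
  LinearMap.BilinForm.finrank_orthogonal killingForm_nondegenerate n

/-- The orthogonal complement of the centralizer of `e` is the tangent space of the orbit of
`e`. -/
lemma range_ad_eq_perp_centralizer [FiniteDimensional ℂ L] [LieAlgebra.IsSemisimple ℂ L] (e : L) :
    LinearMap.range (LieAlgebra.ad ℂ L e) = perp (centralizer e) := by
  refine Submodule.eq_of_le_of_finrank_eq ?_ ?_
  · rintro _ ⟨x, rfl⟩
    refine mem_perp_iff.2 fun z hz => ?_
    have hz' : ⁅e, z⁆ = 0 := hz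
    rw [LieAlgebra.ad_apply, ← lie_skew, map_neg, LinearMap.neg_apply,
      LieModule.traceForm_apply_lie_apply, hz', map_zero, neg_zero]
  · rw [finrank_perp, ← LinearMap.finrank_range_add_finrank_ker (LieAlgebra.ad ℂ L e)]
    exact (Nat.add_sub_cancel _ _).symm

variable {e : L} {n : Submodule ℂ L}

theorem isCompl_range_ad_perp [FiniteDimensional ℂ L] [LieAlgebra.IsSemisimple ℂ L]
    (hcompl : IsCompl (centralizer e) n) :
    IsCompl (LinearMap.range (LieAlgebra.ad ℂ L e)) (perp n) := by
  rw [range_ad_eq_perp_centralizer]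
  have hdisj : Disjoint (perp (centralizer e)) (perp n) := by
    rw [Submodule.disjoint_def]
    intro v hv hv'
    rw [mem_perp_iff] at hv hv'
    refine killingForm_nondegenerate.1 v fun x => ?_
    obtain ⟨a, ha, b, hb, rfl⟩ := Submodule.mem_sup.1
      (hcompl.sup_eq_top ▸ Submodule.mem_top : x ∈ centralizer e ⊔ n)
    rw [map_add, hv a ha, hv' b hb, add_zero]
  refine (Submodule.isCompl_iff_disjoint _ _ ?_).2 hdisj
  have := Submodule.finrank_add_eq_of_isCompl hcompl
  rw [finrank_perp, finrank_perp]
  omega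

/-- A basis of `𝔤` made of bases of the two summands of `𝔤 = 𝔤(e) ⊕ 𝔫`. -/
noncomputable def splitBasis {k m : ℕ} (hcompl : IsCompl (centralizer e) n)
    (Z : Module.Basis (Fin k) ℂ (centralizer e)) (X : Module.Basis (Fin m) ℂ n) :
    Module.Basis (Fin k ⊕ Fin m) ℂ L :=
  (Z.prod X).map (Submodule.prodEquivOfIsCompl _ _ hcompl)

/-- The polynomial in `q₁, …, q_k` which represents the function `y ↦ ⟨y | z⟩` on the slice. -/
noncomputable def sliceFunction (e : L) {k m : ℕ} (W : Module.Basis (Fin k ⊕ Fin m) ℂ L) :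
    L →ₗ[ℂ] MvPolynomial (Fin k) ℂ :=
  W.constr ℂ fun x => Sum.elim X (fun _ => 0) x + C (killingForm ℂ L e (W x))

lemma sliceFunction_basis (e : L) {k m : ℕ} (W : Module.Basis (Fin k ⊕ Fin m) ℂ L)
    (x : Fin k ⊕ Fin m) : sliceFunction e W (W x) =
      Sum.elim X (fun _ => 0) x + C (killingForm ℂ L e (W x)) :=
  W.constr_basis ℂ _ x

variable {k m : ℕ} {hcompl : IsCompl (centralizer e) n}
  {Z : Module.Basis (Fin k) ℂ (centralizer e)} {X : Module.Basis (Fin m) ℂ n}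

@[simp]
lemma splitBasis_inl (i : Fin k) : splitBasis hcompl Z X (.inl i) = Z i := by
  simp [splitBasis]

@[simp]
lemma splitBasis_inr (p : Fin m) : splitBasis hcompl Z X (.inr p) = X p := by
  simp [splitBasis]

lemma sliceFunction_inl (i : Fin k) : sliceFunction e (splitBasis hcompl Z X) (Z i) =
    MvPolynomial.X i + C (killingForm ℂ L e (Z i)) := by
  have := sliceFunction_basis e (splitBasis hcompl Z X) (.inl i)
  rwa [splitBasis_inl] at this

lemma sliceFunction_of_mem {x : L} (hx : x ∈ n) : sliceFunction e (splitBasis hcompl Z X) x =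
    C (killingForm ℂ L e x) := by
  let f : n →ₗ[ℂ] MvPolynomial (Fin k) ℂ := sliceFunction e (splitBasis hcompl Z X) ∘ₗ n.subtype
  let g : n →ₗ[ℂ] MvPolynomial (Fin k) ℂ :=
    Algebra.linearMap ℂ _ ∘ₗ killingForm ℂ L e ∘ₗ n.subtype
  suffices f = g from LinearMap.congr_fun this ⟨x, hx⟩
  refine X.ext fun p => ?_
  have := sliceFunction_basis e (splitBasis hcompl Z X) (.inr p)
  rw [splitBasis_inr] at this
  exact this.trans (zero_add _)

/-- The equality `⟨y | x⟩ = ⟨e | x⟩` for `x ∈ n` is where `y ∈ e + n^⊥` enters. -/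
lemma eval_sliceFunction {y : L} (hy : y ∈ slice e n) (z : L) :
    eval (coord Z y) (sliceFunction e (splitBasis hcompl Z X) z) = killingForm ℂ L y z := by
  let f : L →ₗ[ℂ] ℂ :=
    (aeval (coord Z y) : MvPolynomial (Fin k) ℂ →ₐ[ℂ] ℂ).toLinearMap ∘ₗ
      sliceFunction e (splitBasis hcompl Z X)
  suffices f = killingForm ℂ L y from LinearMap.congr_fun this z
  refine (splitBasis hcompl Z X).ext fun x => ?_
  rcases x with i | p
  · simp [f, sliceFunction_inl, coord]
  · have h0 := mem_perp_iff.1 hy (X p) (X p).2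
    rw [map_sub, LinearMap.sub_apply, sub_eq_zero] at h0
    simp [f, sliceFunction_of_mem (X p).2, h0]

theorem bijOn_coord [FiniteDimensional ℂ L] [LieAlgebra.IsSemisimple ℂ L]
    (hcompl : IsCompl (centralizer e) n)
    (Z : Module.Basis (Fin k) ℂ (centralizer e)) :
    Set.BijOn (coord Z) (slice e n) Set.univ := by
  refine ⟨Set.mapsTo_univ _ _, fun y hy y' hy' h => ?_, fun c _ => ?_⟩
  · have hn : y - y' ∈ perp n := by
      have := (perp n).sub_mem (show y - e ∈ perp n from hy) hy'
      rwa [sub_sub_sub_cancel_right] at this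
    have hc : y - y' ∈ perp (centralizer e) := by
      refine mem_perp_iff.2 fun z hz => ?_
      have h1 : (killingForm ℂ L (y - y')) ∘ₗ (centralizer e).subtype = 0 := by
        refine Z.ext fun i => ?_
        have h2 := congrFun h i
        simp only [coord, map_sub, LinearMap.sub_apply] at h2
        simp only [LinearMap.comp_apply, Submodule.subtype_apply, map_sub, LinearMap.sub_apply,
          LinearMap.zero_apply]
        linear_combination h2
      exact LinearMap.congr_fun h1 ⟨z, hz⟩
    rw [← range_ad_eq_perp_centralizer] at hc
    exact sub_eq_zero.1 (Submodule.disjoint_def.1 (isCompl_range_ad_perp hcompl).disjoint _ hc hn)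
  -- the functional equal to `c i` at `Z i` and to `0` on `n` is represented by some `v ∈ n^⊥`
  · let φ : L →ₗ[ℂ] ℂ := Z.constr ℂ c ∘ₗ (centralizer e).projectionOnto n hcompl
    obtain ⟨v, hv⟩ := (LinearMap.BilinForm.toDual _ killingForm_nondegenerate).surjective φ
    have hv' : ∀ x, killingForm ℂ L v x = φ x := fun x => by
      rw [← hv, LinearMap.BilinForm.toDual_def]
    refine ⟨e + v, ?_, funext fun i => ?_⟩
    · change e + v - e ∈ perp n
      rw [add_sub_cancel_left]
      refine mem_perp_iff.2 fun x hx => ?_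
      rw [hv']
      rw [LinearMap.comp_apply, (Submodule.projectionOnto_apply_eq_zero_iff hcompl).2 hx, map_zero]
    · rw [coord, add_sub_cancel_left, hv']
      simp [φ]

/-! ### The determinant of `C` -/

lemma lieP_sum_smul (y : L) (c : Fin m → ℂ) (s : Fin m) :
    lieP y (∑ p, c p • (X p : L)) (X s) = Matrix.vecMul c (matC X y) s := by
  simp [lieP, matC, Matrix.vecMul, dotProduct, sum_lie]

/-- At `e` itself `C` is non-degenerate, since `[𝔤, e] ∩ 𝔫^⊥ = 0` and `𝔤(e) ∩ 𝔫 = 0`. -/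
lemma det_matC_self_ne_zero [FiniteDimensional ℂ L] [LieAlgebra.IsSemisimple ℂ L]
    (hcompl : IsCompl (centralizer e) n) (X : Module.Basis (Fin m) ℂ n) :
    (matC X e).det ≠ 0 := by
  intro hdet
  obtain ⟨c, hc0, hc⟩ := Matrix.exists_vecMul_eq_zero_iff.2 hdet
  let x : n := ∑ p, c p • X p
  have hx : (x : L) = ∑ p, c p • (X p : L) := by simp [x]
  have h1 : ⁅e, (x : L)⁆ ∈ perp n := by
    refine mem_perp_iff.2 fun z hz => ?_
    have h2 : (killingForm ℂ L ⁅e, (x : L)⁆) ∘ₗ n.subtype = 0 := by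
      refine X.ext fun s => ?_
      rw [LinearMap.comp_apply, Submodule.subtype_apply, ← lieP_eq_killingForm_lie, hx,
        lieP_sum_smul, hc]
      rfl
    exact LinearMap.congr_fun h2 ⟨z, hz⟩
  have h3 : ⁅e, (x : L)⁆ = 0 :=
    Submodule.disjoint_def.1 (isCompl_range_ad_perp hcompl).disjoint _ ⟨x, rfl⟩ h1
  have h4 : (x : L) = 0 := Submodule.disjoint_def.1 hcompl.disjoint _ h3 x.2
  have h5 : ∑ p, c p • X p = 0 := Subtype.ext h4
  exact hc0 (funext (Fintype.linearIndependent_iff.1 X.linearIndependent c h5))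

lemma map_eval_blockC {y : L} (hy : y ∈ slice e n) :
    (blockC (splitBasis hcompl Z X) (sliceFunction e (splitBasis hcompl Z X))).map
      (eval (coord Z y)) = matC X y := by
  ext p s
  simp [blockC, matC, lieP, eval_sliceFunction hy]

section Weights

variable {h : L} (hhe : ⁅h, e⁆ = (2 : ℂ) • e) (hinv : ∀ x ∈ n, ⁅h, x⁆ ∈ n) {wt : Fin k → ℕ}
  (hZ : ∀ i, ⁅h, (Z i : L)⁆ = (wt i : ℂ) • (Z i : L))

include hhe in
lemma killingForm_lie_eq_neg_two_mul (z : L) :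
    killingForm ℂ L e ⁅h, z⁆ = -2 * killingForm ℂ L e z := by
  rw [← LieModule.traceForm_apply_lie_apply, ← lie_skew, hhe, map_neg, LinearMap.neg_apply,
    map_smul, LinearMap.smul_apply, smul_eq_mul, neg_mul]

include hhe hinv hZ in
/-- The Euler field with the weights `n_i + 2` is the restriction to the slice of the field
`y ↦ 2 y - [h, y]`, which vanishes at `e`. -/
lemma euler_sliceFunction (z : L) :
    euler (fun i => wt i + 2) (sliceFunction e (splitBasis hcompl Z X) z) =
      sliceFunction e (splitBasis hcompl Z X) ⁅h, z⁆ +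
        (2 : ℂ) • sliceFunction e (splitBasis hcompl Z X) z := by
  set l := sliceFunction e (splitBasis hcompl Z X) with hl
  let f : L →ₗ[ℂ] MvPolynomial (Fin k) ℂ :=
    (euler (fun i => wt i + 2) : MvPolynomial (Fin k) ℂ →ₗ[ℂ] MvPolynomial (Fin k) ℂ) ∘ₗ l
  let g : L →ₗ[ℂ] MvPolynomial (Fin k) ℂ := l ∘ₗ LieAlgebra.ad ℂ L h + (2 : ℂ) • l
  suffices f = g from LinearMap.congr_fun this z
  refine (splitBasis hcompl Z X).ext fun x => ?_
  rcases x with i | p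
  · have h1 : ((wt i : ℂ) + 2) * killingForm ℂ L e (Z i) = 0 := by
      have := killingForm_lie_eq_neg_two_mul hhe (Z i : L)
      rw [hZ, map_smul, smul_eq_mul] at this
      linear_combination this
    have h2 : ((wt i : ℂ) + 2) • (C (killingForm ℂ L e (Z i)) : MvPolynomial (Fin k) ℂ) = 0 := by
      rw [smul_eq_C_mul, ← C_mul, h1, C_0]
    simp only [f, g, LinearMap.comp_apply, LinearMap.add_apply, LinearMap.smul_apply,
      splitBasis_inl, LieAlgebra.ad_apply, hZ, map_smul, Derivation.coeFn_coe]
    rw [← add_smul, hl, sliceFunction_inl, smul_add, h2, map_add, euler_X]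
    simp
  · simp only [f, g, LinearMap.comp_apply, LinearMap.add_apply, LinearMap.smul_apply,
      splitBasis_inr, LieAlgebra.ad_apply, Derivation.coeFn_coe]
    rw [hl, sliceFunction_of_mem (X p).2, sliceFunction_of_mem (hinv _ (X p).2),
      killingForm_lie_eq_neg_two_mul hhe, smul_eq_C_mul, ← C_mul, ← C_add]
    simp

lemma lie_splitBasis_inr (hinv : ∀ x ∈ n, ⁅h, x⁆ ∈ n) (p : Fin m) :
    ⁅h, splitBasis hcompl Z X (.inr p)⁆ =
      ∑ s, Matrix.of (fun p s => X.repr ⟨⁅h, (X p : L)⁆, hinv _ (X p).2⟩ s) p s •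
        splitBasis hcompl Z X (.inr s) := by
  have := congrArg (Subtype.val) (X.sum_repr ⟨⁅h, (X p : L)⁆, hinv _ (X p).2⟩)
  simp only [splitBasis_inr, Matrix.of_apply]
  rw [AddSubmonoidClass.coe_finsetSum] at this
  exact this.symm

include hhe hinv hZ in
/-- `det C` is an eigenvector of the Euler derivation and does not vanish at `e`, hence is a
non-zero constant. -/
theorem isUnit_det_blockC [FiniteDimensional ℂ L] [LieAlgebra.IsSemisimple ℂ L] : IsUnit
    (blockC (splitBasis hcompl Z X) (sliceFunction e (splitBasis hcompl Z X))).det := by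
  set M := blockC (splitBasis hcompl Z X) (sliceFunction e (splitBasis hcompl Z X)) with hM
  have h1 := derivation_det_of_map_eq (euler fun i => wt i + 2)
    (euler_blockC (euler_sliceFunction (hcompl := hcompl) (X := X) hhe hinv hZ)
      (lie_splitBasis_inr (hcompl := hcompl) (Z := Z) (X := X) hinv))
  rw [← hM] at h1
  set H : Matrix (Fin m) (Fin m) ℂ :=
    Matrix.of fun p s => X.repr ⟨⁅h, (X p : L)⁆, hinv _ (X p).2⟩ s
  have h2 : ((H.map (algebraMap ℂ (MvPolynomial (Fin k) ℂ)) + 2).trace +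
      (H.map (algebraMap ℂ (MvPolynomial (Fin k) ℂ))).transpose.trace) =
      C (H.trace + 2 * m + H.trace) := by
    have h3 : (2 : Matrix (Fin m) (Fin m) (MvPolynomial (Fin k) ℂ)).trace = C (2 * m : ℂ) := by
      rw [← one_add_one_eq_two, Matrix.trace_add, Matrix.trace_one]
      simp [two_mul]
    have h4 : (H.map (algebraMap ℂ (MvPolynomial (Fin k) ℂ))).trace = C H.trace :=
      (AddMonoidHom.map_trace (C : ℂ →+* MvPolynomial (Fin k) ℂ) H).symm
    rw [Matrix.trace_add, Matrix.trace_transpose, h3, h4, C_add, C_add]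
  rw [h2, ← smul_eq_C_mul] at h1
  have he : e ∈ slice e n := by
    change e - e ∈ perp n
    rw [sub_self]
    exact zero_mem _
  have hce : coord Z e = 0 := by
    funext i
    simp [coord]
  have h0 : coeff 0 M.det ≠ 0 := by
    have h5 : coeff 0 M.det = eval (coord Z e) M.det := by
      rw [hce, eval_zero, constantCoeff_eq]
    rw [h5, RingHom.map_det, RingHom.mapMatrix_apply, hM, map_eval_blockC he]
    exact det_matC_self_ne_zero hcompl X
  rw [eq_C_of_euler_eq_smul _ (fun i => Nat.succ_pos _) h1 h0]
  exact (isUnit_iff_ne_zero.2 h0).map C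

end Weights

/-! ### Adapted covectors at the points of the slice -/

section Adapted

variable (hcompl X) in
/-- The value at `y` of the covector field adapted to `q_i`. -/
noncomputable def adaptedAt (Z : Module.Basis (Fin k) ℂ (centralizer e)) (y : L) (i : Fin k) : L :=
  evalTensor L (aeval (coord Z y) : MvPolynomial (Fin k) ℂ →ₐ[ℂ] ℂ)
    (adapted (splitBasis hcompl Z X) (sliceFunction e (splitBasis hcompl Z X)) i)

lemma adaptedAt_sub_mem (y : L) (i : Fin k) : adaptedAt hcompl X Z y i - Z i ∈ n := by
  have : adaptedAt hcompl X Z y i - Z i = ∑ p, eval (coord Z y) (adaptedCoeff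
      (splitBasis hcompl Z X) (sliceFunction e (splitBasis hcompl Z X)) i p) • (X p : L) := by
    simp [adaptedAt, adapted, aeval_eq_eval]
  rw [this]
  exact sum_mem fun p _ => n.smul_mem _ (X p).2

lemma eval_pairing_lie {y : L} (hy : y ∈ slice e n)
    (v w : TensorProduct ℂ (MvPolynomial (Fin k) ℂ) L) :
    eval (coord Z y) (pairing (sliceFunction e (splitBasis hcompl Z X)) ⁅v, w⁆) =
      lieP y (evalTensor L (aeval (coord Z y) : MvPolynomial (Fin k) ℂ →ₐ[ℂ] ℂ) v)
        (evalTensor L (aeval (coord Z y) : MvPolynomial (Fin k) ℂ →ₐ[ℂ] ℂ) w) := by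
  rw [lieP, ← evalTensor_lie]
  exact map_pairing (φ := (aeval (coord Z y) : MvPolynomial (Fin k) ℂ →ₐ[ℂ] ℂ))
    (fun z => eval_sliceFunction hy z) _

lemma lieP_adaptedAt_adaptedAt {y : L} (hy : y ∈ slice e n) (i j : Fin k) :
    lieP y (adaptedAt hcompl X Z y i) (adaptedAt hcompl X Z y j) =
      eval (coord Z y) (reducedMatrix (splitBasis hcompl Z X)
        (sliceFunction e (splitBasis hcompl Z X)) i j) :=
  (eval_pairing_lie hy _ _).symm

variable (hC : IsUnit
  (blockC (splitBasis hcompl Z X) (sliceFunction e (splitBasis hcompl Z X))).det)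
include hC

lemma lieP_adaptedAt_of_mem {y : L} (hy : y ∈ slice e n) (i : Fin k) {x : L} (hx : x ∈ n) :
    lieP y (adaptedAt hcompl X Z y i) x = 0 := by
  rw [lieP_eq_killingForm_lie]
  have h1 : (killingForm ℂ L ⁅y, adaptedAt hcompl X Z y i⁆) ∘ₗ n.subtype = 0 := by
    refine X.ext fun s => ?_
    have := congrArg (eval (coord Z y)) (pairing_adapted_inr hC i s)
    rw [eval_pairing_lie hy, evalTensor_tmul, map_one, one_smul, splitBasis_inr, map_zero] at this
    rwa [LinearMap.comp_apply, Submodule.subtype_apply, ← lieP_eq_killingForm_lie]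
  exact LinearMap.congr_fun h1 ⟨x, hx⟩

theorem isUnit_det_matC {y : L} (hy : y ∈ slice e n) : IsUnit (matC X y).det := by
  have := hC.map (eval (coord Z y))
  rwa [RingHom.map_det, RingHom.mapMatrix_apply, map_eval_blockC hy] at this

lemma eq_zero_of_lieP_eq_zero {y : L} (hy : y ∈ slice e n) {x : L} (hx : x ∈ n)
    (h : ∀ x' ∈ n, lieP y x x' = 0) : x = 0 := by
  have hsum : x = ∑ p, X.repr ⟨x, hx⟩ p • (X p : L) := by
    have := congrArg Subtype.val (X.sum_repr ⟨x, hx⟩)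
    simpa only [AddSubmonoidClass.coe_finsetSum, SetLike.val_smul] using this.symm
  have hc : Matrix.vecMul (fun p => X.repr ⟨x, hx⟩ p) (matC X y) = 0 := by
    funext s
    rw [← lieP_sum_smul, ← hsum]
    exact h _ (X s).2
  have h0 := Matrix.eq_zero_of_vecMul_eq_zero (isUnit_det_matC hC hy).ne_zero hc
  rw [hsum]
  exact Finset.sum_eq_zero fun p _ => by rw [congrFun h0 p, Pi.zero_apply, zero_smul]

lemma isAdapted_sum {y : L} (hy : y ∈ slice e n) (F : MvPolynomial (Fin k) ℂ) :
    IsAdapted n Z y F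
      (∑ i, eval (coord Z y) (pderiv i F) • adaptedAt hcompl X Z y i) := by
  refine ⟨fun v hv => ?_, fun x hx => ?_⟩
  · rw [map_sum]
    refine Finset.sum_congr rfl fun i _ => ?_
    have := mem_perp_iff.1 hv _ (adaptedAt_sub_mem (hcompl := hcompl) (X := X) (Z := Z) y i)
    rw [map_sub, sub_eq_zero] at this
    rw [map_smul, this, smul_eq_mul]
  · rw [lieP, sum_lie, map_sum]
    refine Finset.sum_eq_zero fun i _ => ?_
    rw [smul_lie, map_smul]
    have := lieP_adaptedAt_of_mem hC hy i hx
    rw [lieP] at this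
    rw [this, smul_zero]

lemma isAdapted_unique [FiniteDimensional ℂ L] [LieAlgebra.IsSemisimple ℂ L] {y : L}
    (hy : y ∈ slice e n) {F : MvPolynomial (Fin k) ℂ} {ξ η : L}
    (hξ : IsAdapted n Z y F ξ) (hη : IsAdapted n Z y F η) : ξ = η := by
  have hmem : ξ - η ∈ n := by
    rw [← perp_perp n]
    refine mem_perp_iff.2 fun v hv => ?_
    rw [LieModule.traceForm_comm, map_sub, hξ.1 v hv, hη.1 v hv, sub_self]
  refine sub_eq_zero.1 (eq_zero_of_lieP_eq_zero hC hy hmem fun x hx => ?_)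
  have h1 := hξ.2 x hx
  have h2 := hη.2 x hx
  rw [lieP] at h1 h2 ⊢
  rw [sub_lie, map_sub, h1, h2, sub_self]

theorem isTransversePoisson_reducedMatrix [FiniteDimensional ℂ L] [LieAlgebra.IsSemisimple ℂ L] :
    IsTransversePoisson n Z (matrixBracket (reducedMatrix
      (splitBasis hcompl Z X) (sliceFunction e (splitBasis hcompl Z X)))) where
  isPoisson := by
    refine isPoisson_matrixBracket (reducedMatrix_skew _ _) fun i j s =>
      coordField_reducedMatrix_jacobi (D := fun i => mkDerivation ℂ (reducedMatrix
        (splitBasis hcompl Z X) (sliceFunction e (splitBasis hcompl Z X)) i)) hC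
        (fun i j => ?_) (fun i p => ?_) i j s
    · rw [sliceFunction_basis]
      simp
    · rw [sliceFunction_basis]
      simp
  existsUnique_adapted y hy F :=
    ⟨_, isAdapted_sum hC hy F, fun _ h => isAdapted_unique hC hy h (isAdapted_sum hC hy F)⟩
  eval_bracket y hy F G ξ η hξ hη := by
    rw [isAdapted_unique hC hy hξ (isAdapted_sum hC hy F),
      isAdapted_unique hC hy hη (isAdapted_sum hC hy G), matrixBracket_eq_sum, map_sum, lieP,
      sum_lie_sum, map_sum]
    refine Finset.sum_congr rfl fun i _ => ?_
    rw [map_sum, map_sum]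
    refine Finset.sum_congr rfl fun j _ => ?_
    rw [smul_lie, lie_smul, map_smul, map_smul, map_mul, map_mul, ← lieP_adaptedAt_adaptedAt hy,
      lieP, smul_eq_mul, smul_eq_mul, mul_assoc]

theorem eval_reducedMatrix {y : L} (hy : y ∈ slice e n) (i j : Fin k) :
    eval (coord Z y) (reducedMatrix (splitBasis hcompl Z X)
      (sliceFunction e (splitBasis hcompl Z X)) i j) = diracMatrix Z X y i j := by
  set W := splitBasis hcompl Z X with hW
  have hA : (blockA W (sliceFunction e W)).map (eval (coord Z y)) = matA Z y := by
    ext i j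
    simp [hW, blockA, matA, lieP, eval_sliceFunction hy]
  have hB : (blockB W (sliceFunction e W)).map (eval (coord Z y)) = matB Z X y := by
    ext i p
    simp [hW, blockB, matB, lieP, eval_sliceFunction hy]
  have hCi : (blockC W (sliceFunction e W))⁻¹.map (eval (coord Z y)) = (matC X y)⁻¹ := by
    refine (Matrix.inv_eq_left_inv ?_).symm
    rw [← map_eval_blockC (hcompl := hcompl) (Z := Z) hy, ← Matrix.map_mul,
      Matrix.nonsing_inv_mul _ hC]
    simp
  have := congrArg (fun M => M.map (eval (coord Z y)) i j) (reducedMatrix_eq hC)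
  simp only [Matrix.map_apply] at this
  rw [this, diracMatrix, ← hA, ← hB, ← hCi, ← Matrix.map_mul, ← Matrix.transpose_map,
    ← Matrix.map_mul, Matrix.add_apply, map_add]
  rfl

end Adapted

end Slice

end TransversePoisson

open TransversePoisson in
theorem mainTheorem3 {L : Type*} [LieRing L] [LieAlgebra ℂ L] [FiniteDimensional ℂ L]
    [LieAlgebra.IsSemisimple ℂ L]
    (h e f : L) (hhe : ⁅h, e⁆ = (2 : ℂ) • e) (hhf : ⁅h, f⁆ = (-2 : ℂ) • f) (hef : ⁅e, f⁆ = h)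
    (n : Submodule ℂ L) (hcompl : IsCompl (centralizer e) n) (hinv : ∀ x ∈ n, ⁅h, x⁆ ∈ n)
    {k m : ℕ} (Z : Module.Basis (Fin k) ℂ (centralizer e)) (wt : Fin k → ℕ)
    (hZ : ∀ i, ⁅h, (Z i : L)⁆ = (wt i : ℂ) • (Z i : L))
    (X : Module.Basis (Fin m) ℂ n) :
    -- `N` is a transverse slice at `e`, and the `q_i` are coordinates on it
    IsCompl (LinearMap.range (LieAlgebra.ad ℂ L e)) (perp n) ∧
    Set.BijOn (coord Z) (slice e n) Set.univ ∧
    -- Dirac's formula makes sense on the whole of `N`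
    (∀ y ∈ slice e n, IsUnit (matC X y).det) ∧
    -- the transverse Poisson structure is polynomial and quasi-homogeneous
    ∃ b : Bracket k, IsTransversePoisson n Z b ∧
      (∀ y ∈ slice e n, ∀ i j,
        eval (coord Z y) (b (MvPolynomial.X i) (MvPolynomial.X j)) = diracMatrix Z X y i j) ∧
      IsQuasiHomogeneousBracket (fun i => wt i + 2) b (-2) := by
  have hC := isUnit_det_blockC (hcompl := hcompl) (X := X) hhe hinv hZ
  refine ⟨isCompl_range_ad_perp hcompl, bijOn_coord hcompl Z, fun y hy => isUnit_det_matC hC hy,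
    _, isTransversePoisson_reducedMatrix hC, fun y hy i j => ?_,
    isQuasiHomogeneousBracket_matrixBracket _ (reducedMatrix_skew _ _) fun i j => ?_⟩
  · rw [matrixBracket_X_X]
    exact eval_reducedMatrix hC hy i j
  · rw [euler_reducedMatrix (euler_sliceFunction hhe hinv hZ) (lie_splitBasis_inr hinv) hC
      (wt := fun i => (wt i : ℂ)) (fun i => by rw [splitBasis_inl]; exact hZ i)]
    congr 1
    push_cast
    ring
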